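/- For each $\mu\in\mathbb C$ let $S_n(z)=S_n(z;\mu)$, $n\ge -1$, be the rational functions of $z$ defined by $S_{-1}=S_0=1$ and the recurrence relation $$S_{n+1}S_{n-1}=-z\left[S_n\frac{d^2S_n}{dz^2}-\left(\frac{dS_n}{dz}\right)^2\right]-S_n\frac{dS_n}{dz}+(z+\mu)S_n^2,\qquad n\ge 0$$ (no $S_n$ is the zero function, so this determines $S_{n+1}$). Then: (i) For all $\mu\in\mathbb C$ and $n\ge 0$, $S_n(z;\mu)$ has no pole at $z=0$. Put $\phi_n=\phi_n(\mu)=S_n(0;\mu)$ and $\phi_n'=\phi_n'(\mu)=\frac{\partial S_n}{\partial z}(0;\mu)$. For every $n\ge 0$ the set of $\mu\in\mathbb C$ with $\phi_n(\mu)=0$ is finite. (ii) For all $n\ge 3$ and all $\mu\in\mathbb C$ with $\phi_{n-2}\ne 0$ and $\phi_{n-1}\neq 0$, $$\phi_{n+1}=\frac{\phi_n\phi_{n-1}}{\phi_{n-2}}\left(2\mu^2-2n^2+2n-1-\frac{\phi_n\phi_{n-3}}{\phi_{n-1}\phi_{n-2}}\right).$$ (iii) For all $n\ge 3$ and all $\mu\in\mathbb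 C$ with $\phi_{n+1}\ne 0$, $$\phi'_{n+1}=-\frac{\phi_n\phi_{n+2}}{\phi_{n+1}}+\mu\,\phi_{n+1}.$$ -/

import Mathlib

noncomputable section

namespace Umemura

open Polynomial

/-- The derivative `d/dz` of a rational function over `ℂ`, by the quotient rule. -/
def deriv (f : RatFunc ℂ) : RatFunc ℂ :=
  (algebraMap ℂ[X] (RatFunc ℂ) (derivative f.num * f.denom - f.num * derivative f.denom)) /
    (algebraMap ℂ[X] (RatFunc ℂ) f.denom) ^ 2

/-- The right-hand side of the recurrence relation,
`-z (S S'' - (S')²) - S S' + (z + μ) S²`, with `z = RatFunc.X`. -/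
def recRHS (μ : ℂ) (S : RatFunc ℂ) : RatFunc ℂ :=
  -RatFunc.X * (S * deriv (deriv S) - deriv S ^ 2) - S * deriv S +
    (RatFunc.X + RatFunc.C μ) * S ^ 2

/-- The sequence with the index shifted by one: `shiftedS μ k` is `S_{k-1}(z; μ)`, so that
`S_{-1} = S_0 = 1` and `S_{n+1} = recRHS S_n / S_{n-1}`. The division is a genuine one,
see `S_ne_zero` and `S_recurrence`. -/
def shiftedS (μ : ℂ) : ℕ → RatFunc ℂ
  | 0 => 1
  | 1 => 1
  | k + 2 => recRHS μ (shiftedS μ (k + 1)) / shiftedS μ k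

/-- `S_n(z; μ)` for `n ≥ 0`, a rational function of `z`. -/
def S (μ : ℂ) (n : ℕ) : RatFunc ℂ := shiftedS μ (n + 1)

/-- `f` has no pole at `z = 0`. -/
def RegularAtZero (f : RatFunc ℂ) : Prop := f.denom.eval 0 ≠ 0

/-- The value `f(0)`; meaningful when `RegularAtZero f`. -/
def evalZero (f : RatFunc ℂ) : ℂ := f.eval (RingHom.id ℂ) 0

/-- `φ_n = S_n(0; μ)`. -/
def phi (μ : ℂ) (n : ℕ) : ℂ := evalZero (S μ n)

/-- `φ_n' = (∂S_n/∂z)(0; μ)`. -/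
def phi' (μ : ℂ) (n : ℕ) : ℂ := evalZero (deriv (S μ n))

/-- `f` is zero or has degree (numerator minus denominator) at most `d`. -/
def DegLE (f : RatFunc ℂ) (d : ℤ) : Prop := f = 0 ∨ f.intDegree ≤ d

theorem DegLE.mul {f g : RatFunc ℂ} {a b : ℤ} (hf : DegLE f a) (hg : DegLE g b) :
    DegLE (f * g) (a + b) := by
  by_cases hf0 : f = 0
  · left; simp [hf0]
  by_cases hg0 : g = 0
  · left; simp [hg0]
  right
  rw [RatFunc.intDegree_mul hf0 hg0]
  have h1 := hf.resolve_left hf0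
  have h2 := hg.resolve_left hg0
  lia

theorem DegLE.add {f g : RatFunc ℂ} {a : ℤ} (hf : DegLE f a) (hg : DegLE g a) :
    DegLE (f + g) a := by
  by_cases hf0 : f = 0
  · simpa [hf0] using hg
  by_cases hg0 : g = 0
  · simpa [hg0] using hf
  by_cases h : f + g = 0
  · exact Or.inl h
  exact Or.inr ((RatFunc.intDegree_add_le hg0 h).trans
    (max_le (hf.resolve_left hf0) (hg.resolve_left hg0)))

theorem DegLE.neg {f : RatFunc ℂ} {a : ℤ} (hf : DegLE f a) : DegLE (-f) a := by
  rcases hf with h | h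
  · left; simp [h]
  · right; rwa [RatFunc.intDegree_neg]

theorem degLE_deriv {f : RatFunc ℂ} {a : ℤ} (hf : DegLE f a) : DegLE (deriv f) (a - 1) := by
  by_cases hf0 : f = 0
  · left; simp [hf0, deriv]
  have ha := hf.resolve_left hf0
  set N : ℂ[X] := derivative f.num * f.denom - f.num * derivative f.denom with hN
  by_cases h0 : N = 0
  · left; simp [deriv, ← hN, h0]
  right
  have hd0 : (algebraMap ℂ[X] (RatFunc ℂ) f.denom) ≠ 0 := by
    simpa using f.denom_ne_zero
  have hn0 : (algebraMap ℂ[X] (RatFunc ℂ) N) ≠ 0 := by simpa using h0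
  have key : (N.natDegree : ℤ) ≤ f.num.natDegree + f.denom.natDegree - 1 := by
    by_cases hp : derivative f.num = 0
    · have hq : derivative f.denom ≠ 0 := by
        intro hq; apply h0; rw [hN, hp, hq]; simp
      have hq1 : f.denom.natDegree ≠ 0 := by
        intro h; apply hq
        exact derivative_of_natDegree_zero h
      have h1 : N.natDegree ≤ f.num.natDegree + (derivative f.denom).natDegree := by
        rw [hN, hp, zero_mul, zero_sub, natDegree_neg]
        exact natDegree_mul_le
      have h2 := natDegree_derivative_lt hq1
      lia
    · have hp1 : f.num.natDegree ≠ 0 := by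
        intro h; apply hp
        exact derivative_of_natDegree_zero h
      have h2 := natDegree_derivative_lt hp1
      have h3 : (f.num * derivative f.denom).natDegree + 1 ≤
          f.num.natDegree + f.denom.natDegree := by
        by_cases hq1 : f.denom.natDegree = 0
        · rw [derivative_of_natDegree_zero hq1]
          simp
          lia
        · have h4 := natDegree_derivative_lt hq1
          have h5 := natDegree_mul_le (p := f.num) (q := derivative f.denom)
          lia
      have h6 := natDegree_mul_le (p := derivative f.num) (q := f.denom)
      have h7 := natDegree_sub_le (derivative f.num * f.denom) (f.num * derivative f.denom)
      rw [← hN] at h7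
      have h8 := max_le (a := (derivative f.num * f.denom).natDegree)
        (b := (f.num * derivative f.denom).natDegree)
        (c := f.num.natDegree + f.denom.natDegree - 1) (by lia) (by lia)
      lia
  have hsq : (algebraMap ℂ[X] (RatFunc ℂ) f.denom) ^ 2 ≠ 0 := pow_ne_zero 2 hd0
  rw [deriv, ← hN, RatFunc.intDegree_div hn0 hsq, pow_two, RatFunc.intDegree_mul hd0 hd0,
    RatFunc.intDegree_polynomial, RatFunc.intDegree_polynomial]
  rw [RatFunc.intDegree] at ha
  lia

theorem recRHS_ne_zero (μ : ℂ) {f : RatFunc ℂ} (hf : f ≠ 0) : recRHS μ f ≠ 0 := by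
  intro h
  have hd : DegLE f f.intDegree := Or.inr le_rfl
  have h1 := degLE_deriv hd
  have h2 := degLE_deriv h1
  have hX : DegLE (RatFunc.X : RatFunc ℂ) 1 := Or.inr (by simp)
  have e : (RatFunc.X + RatFunc.C μ) * (f * f) =
      RatFunc.X * (f * deriv (deriv f) + -(deriv f * deriv f)) + f * deriv f := by
    rw [recRHS] at h
    linear_combination h
  have lin : (RatFunc.X + RatFunc.C μ : RatFunc ℂ) = algebraMap ℂ[X] (RatFunc ℂ) (X + C μ) := by
    simp
  have lin0 : (RatFunc.X + RatFunc.C μ : RatFunc ℂ) ≠ 0 := by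
    rw [lin]
    exact RatFunc.algebraMap_ne_zero (X_add_C_ne_zero μ)
  have b1 : DegLE (f * deriv (deriv f)) (2 * f.intDegree - 2) := by
    have := hd.mul h2
    rwa [show f.intDegree + (f.intDegree - 1 - 1) = 2 * f.intDegree - 2 by ring] at this
  have b2 : DegLE (deriv f * deriv f) (2 * f.intDegree - 2) := by
    have := h1.mul h1
    rwa [show f.intDegree - 1 + (f.intDegree - 1) = 2 * f.intDegree - 2 by ring] at this
  have b3 : DegLE (f * deriv f) (1 + (2 * f.intDegree - 2)) := by
    have := hd.mul h1
    rwa [show f.intDegree + (f.intDegree - 1) = 1 + (2 * f.intDegree - 2) by ring] at this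
  have b := (hX.mul (b1.add b2.neg)).add b3
  rw [← e] at b
  have b' := b.resolve_left (mul_ne_zero lin0 (mul_ne_zero hf hf))
  rw [RatFunc.intDegree_mul lin0 (mul_ne_zero hf hf), RatFunc.intDegree_mul hf hf, lin,
    RatFunc.intDegree_polynomial, natDegree_X_add_C] at b'
  push_cast at b'
  lia

theorem shiftedS_ne_zero (μ : ℂ) (k : ℕ) : shiftedS μ k ≠ 0 ∧ shiftedS μ (k + 1) ≠ 0 := by
  induction k with
  | zero => simp [shiftedS]
  | succ k ih =>
    refine ⟨ih.2, ?_⟩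
    rw [shiftedS]
    exact div_ne_zero (recRHS_ne_zero μ ih.2) ih.1

theorem S_ne_zero (μ : ℂ) (n : ℕ) : S μ n ≠ 0 := (shiftedS_ne_zero μ n).2

theorem shiftedS_recurrence (μ : ℂ) (k : ℕ) :
    shiftedS μ (k + 2) * shiftedS μ k = recRHS μ (shiftedS μ (k + 1)) := by
  rw [shiftedS]
  exact div_mul_cancel₀ _ (shiftedS_ne_zero μ k).1

/-- The recurrence relation in product form, together with the case `n = 0`, where `S_{-1} = 1`. -/
theorem S_recurrence (μ : ℂ) :
    S μ 0 = 1 ∧ S μ 1 * 1 = recRHS μ (S μ 0) ∧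
      ∀ n : ℕ, S μ (n + 2) * S μ n = recRHS μ (S μ (n + 1)) := by
  refine ⟨by simp [S, shiftedS], ?_, fun n => shiftedS_recurrence μ (n + 1)⟩
  simp [S, shiftedS]

end Umemura

end

noncomputable section

namespace Umemura

open Polynomial

local notation "ι" => algebraMap ℂ[X] (RatFunc ℂ)

/-! Put r_n = S_{n+1} S_{n-1} / S_n² and D_n = (log (S_n / S_{n-1}))'. The recurrence becomes r_n =
z + μ - (z S_n'/S_n)', whence r_{n+1} = r_n - (z D_{n+1})' and r_n' = (D_{n+1} - D_n) r_n. An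
induction (`adlerMoser_aux`) gives (D_{n+1} + D_n) r_n = 2n + 1.

While S_{n-1} and S_n are nonzero at 0 (`UnitAtZero`), these relations at z = 0 yield r_n (r_n +
D_n) = μ² - n², and r_n + D_n = r_{n-1} there for n ≥ 1. So r_n r_{n-1} = μ² - n² at 0, that is,
φ_{n+1} φ_{n-2} = (μ² - n²) φ_n φ_{n-1}. Claim (ii) combines this with the same identity for n - 1,
since 2μ² - 2n² + 2n - 1 = (μ² - n²) + (μ² - (n-1)²).

The nonvanishing can only break down when μ² = M² for an integer M ≥ 0. From then on
(`LadderAtZero`) the order of S_{M+j} at 0 exceeds that of S_{M+j-1} by exactly j, so no pole ever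
appears. Hence (i), with the zeros of φ_n among ±j, j < n. Claim (iii) is the original recurrence at
z = 0. -/

/-! ### Differential calculus in ℂ(z). -/

/-- The quotient rule does not need the reduced fraction: differentiate the cross-multiplied
identity between the two representations. All differentiation rules below follow from this. -/
theorem deriv_mul_sq {f : RatFunc ℂ} {p q : ℂ[X]} (h : f * ι q = ι p) :
    deriv f * ι q ^ 2 = ι (derivative p * q - p * derivative q) := by
  have hd : ι f.denom ≠ 0 := by simpa using f.denom_ne_zero
  have hf : f = ι f.num / ι f.denom := (RatFunc.num_div_denom f).symm
  have e : f.num * q = p * f.denom := by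
    apply RatFunc.algebraMap_injective ℂ
    rw [hf] at h
    rw [map_mul, map_mul, ← h]
    field_simp
  have e' := congrArg derivative e
  simp only [derivative_mul] at e'
  have key : (derivative f.num * f.denom - f.num * derivative f.denom) * q ^ 2 =
      (derivative p * q - p * derivative q) * f.denom ^ 2 := by
    linear_combination (f.denom * q) * e' - (f.denom * derivative q + q * derivative f.denom) * e
  rw [deriv, div_mul_eq_mul_div, div_eq_iff (pow_ne_zero 2 hd), ← map_pow, ← map_pow,
    ← map_mul, ← map_mul, key]

theorem exists_mul_eq (f : RatFunc ℂ) : ∃ p q : ℂ[X], ι q ≠ 0 ∧ f * ι q = ι p := by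
  have hd : ι f.denom ≠ 0 := by simpa using f.denom_ne_zero
  exact ⟨f.num, f.denom, hd, (eq_div_iff hd).1 (RatFunc.num_div_denom f).symm⟩

theorem deriv_algebraMap (p : ℂ[X]) : deriv (ι p) = ι (derivative p) := by
  have := deriv_mul_sq (f := ι p) (p := p) (q := 1) (by simp)
  simpa using this

theorem deriv_C (a : ℂ) : deriv (RatFunc.C a) = 0 := by
  have := deriv_algebraMap (C a)
  simpa using this

theorem deriv_X : deriv RatFunc.X = 1 := by
  have := deriv_algebraMap X
  simpa using this

theorem deriv_add (f g : RatFunc ℂ) : deriv (f + g) = deriv f + deriv g := by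
  obtain ⟨p, q, hq, h⟩ := exists_mul_eq f
  obtain ⟨p', q', hq', h'⟩ := exists_mul_eq g
  have e := deriv_mul_sq (f := f + g) (p := p * q' + p' * q) (q := q * q') (by
    simp only [map_mul, map_add]; linear_combination ι q' * h + ι q * h')
  have a := deriv_mul_sq h
  have b := deriv_mul_sq h'
  refine mul_right_cancel₀ (pow_ne_zero 2 (mul_ne_zero hq hq')) ?_
  simp only [derivative_mul, map_mul, map_sub, map_add] at e a b
  linear_combination e - ι q' ^ 2 * a - ι q ^ 2 * b

theorem deriv_mul (f g : RatFunc ℂ) : deriv (f * g) = deriv f * g + f * deriv g := by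
  obtain ⟨p, q, hq, h⟩ := exists_mul_eq f
  obtain ⟨p', q', hq', h'⟩ := exists_mul_eq g
  have e := deriv_mul_sq (f := f * g) (p := p * p') (q := q * q') (by
    simp only [map_mul]; linear_combination ι q' * g * h + ι p * h')
  have a := deriv_mul_sq h
  have b := deriv_mul_sq h'
  refine mul_right_cancel₀ (pow_ne_zero 2 (mul_ne_zero hq hq')) ?_
  simp only [derivative_mul, map_mul, map_sub, map_add] at e a b
  linear_combination e - g * ι q' ^ 2 * a - ι q ^ 2 * f * b
    - ι q' * (ι (derivative p) * ι q - ι p * ι (derivative q)) * h'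
    - ι q * (ι (derivative p') * ι q' - ι p' * ι (derivative q')) * h

theorem deriv_neg (f : RatFunc ℂ) : deriv (-f) = -deriv f := by
  have := deriv_mul (RatFunc.C (-1)) f
  rw [deriv_C] at this
  simpa using this

theorem deriv_sub (f g : RatFunc ℂ) : deriv (f - g) = deriv f - deriv g := by
  rw [sub_eq_add_neg, deriv_add, deriv_neg, sub_eq_add_neg]

theorem deriv_natCast (n : ℕ) : deriv (n : RatFunc ℂ) = 0 := by
  simpa using deriv_C n

theorem deriv_one : deriv (1 : RatFunc ℂ) = 0 := by
  simpa using deriv_natCast 1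

/-- The logarithmic derivative. -/
def logDeriv (f : RatFunc ℂ) : RatFunc ℂ := deriv f / f

theorem deriv_eq_logDeriv_mul {f : RatFunc ℂ} (hf : f ≠ 0) : deriv f = logDeriv f * f :=
  (div_mul_cancel₀ _ hf).symm

theorem logDeriv_mul {f g : RatFunc ℂ} (hf : f ≠ 0) (hg : g ≠ 0) :
    logDeriv (f * g) = logDeriv f + logDeriv g := by
  rw [logDeriv, logDeriv, logDeriv, deriv_mul]
  field_simp

/-! ### The local ring at z = 0 and evaluation there. -/

theorem regularAtZero_of_mul_eq {f : RatFunc ℂ} {p q : ℂ[X]} (hq : q.eval 0 ≠ 0)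
    (h : f * ι q = ι p) : RegularAtZero f := by
  have hq0 : q ≠ 0 := by rintro rfl; simp at hq
  have hd := RatFunc.denom_div_dvd p q
  rw [← (eq_div_iff (RatFunc.algebraMap_ne_zero hq0)).2 h] at hd
  obtain ⟨c, hc⟩ := hd
  intro h0
  apply hq
  rw [hc, eval_mul, h0, zero_mul]

theorem RegularAtZero.exists_mul_eq {f : RatFunc ℂ} (hf : RegularAtZero f) :
    ∃ p q : ℂ[X], q.eval 0 ≠ 0 ∧ f * ι q = ι p := by
  have hd : ι f.denom ≠ 0 := by simpa using f.denom_ne_zero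
  exact ⟨f.num, f.denom, hf, (eq_div_iff hd).1 (RatFunc.num_div_denom f).symm⟩

theorem regularAtZero_algebraMap (p : ℂ[X]) : RegularAtZero (ι p) :=
  regularAtZero_of_mul_eq (p := p) (q := 1) (by simp) (by simp)

theorem regularAtZero_X : RegularAtZero RatFunc.X := by
  simpa using regularAtZero_algebraMap X

theorem regularAtZero_C (a : ℂ) : RegularAtZero (RatFunc.C a) := by
  simpa using regularAtZero_algebraMap (C a)

theorem regularAtZero_natCast (n : ℕ) : RegularAtZero (n : RatFunc ℂ) := by
  simpa using regularAtZero_C n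

theorem RegularAtZero.add {f g : RatFunc ℂ} (hf : RegularAtZero f) (hg : RegularAtZero g) :
    RegularAtZero (f + g) := by
  obtain ⟨p, q, hq, h⟩ := hf.exists_mul_eq
  obtain ⟨p', q', hq', h'⟩ := hg.exists_mul_eq
  refine regularAtZero_of_mul_eq (p := p * q' + p' * q) (q := q * q') (by simp [hq, hq']) ?_
  simp only [map_mul, map_add]; linear_combination ι q' * h + ι q * h'

theorem RegularAtZero.mul {f g : RatFunc ℂ} (hf : RegularAtZero f) (hg : RegularAtZero g) :
    RegularAtZero (f * g) := by
  obtain ⟨p, q, hq, h⟩ := hf.exists_mul_eq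
  obtain ⟨p', q', hq', h'⟩ := hg.exists_mul_eq
  refine regularAtZero_of_mul_eq (p := p * p') (q := q * q') (by simp [hq, hq']) ?_
  simp only [map_mul]; linear_combination ι q' * g * h + ι p * h'

theorem RegularAtZero.neg {f : RatFunc ℂ} (hf : RegularAtZero f) : RegularAtZero (-f) := by
  obtain ⟨p, q, hq, h⟩ := hf.exists_mul_eq
  exact regularAtZero_of_mul_eq (p := -p) (q := q) hq (by simp [h])

theorem RegularAtZero.sub {f g : RatFunc ℂ} (hf : RegularAtZero f) (hg : RegularAtZero g) :
    RegularAtZero (f - g) := by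
  rw [sub_eq_add_neg]; exact hf.add hg.neg

theorem RegularAtZero.pow {f : RatFunc ℂ} (hf : RegularAtZero f) (n : ℕ) :
    RegularAtZero (f ^ n) := by
  induction n with
  | zero => simpa using regularAtZero_natCast 1
  | succ n ih => rw [pow_succ]; exact ih.mul hf

theorem RegularAtZero.deriv {f : RatFunc ℂ} (hf : RegularAtZero f) :
    RegularAtZero (deriv f) := by
  obtain ⟨p, q, hq, h⟩ := hf.exists_mul_eq
  exact regularAtZero_of_mul_eq (p := derivative p * q - p * derivative q) (q := q ^ 2) (by simp [hq])
    (by rw [map_pow]; exact deriv_mul_sq h)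

theorem evalZero_algebraMap (p : ℂ[X]) : evalZero (ι p) = p.eval 0 := by
  rw [evalZero, RatFunc.eval_algebraMap]; rfl

theorem evalZero_X : evalZero RatFunc.X = 0 := by
  simpa using evalZero_algebraMap X

theorem evalZero_C (a : ℂ) : evalZero (RatFunc.C a) = a := by
  simpa using evalZero_algebraMap (C a)

theorem evalZero_natCast (n : ℕ) : evalZero (n : RatFunc ℂ) = n := by
  simpa using evalZero_C n

theorem evalZero_add {f g : RatFunc ℂ} (hf : RegularAtZero f) (hg : RegularAtZero g) :
    evalZero (f + g) = evalZero f + evalZero g :=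
  RatFunc.eval_add _ _ hf hg

theorem evalZero_mul {f g : RatFunc ℂ} (hf : RegularAtZero f) (hg : RegularAtZero g) :
    evalZero (f * g) = evalZero f * evalZero g :=
  RatFunc.eval_mul _ _ hf hg

theorem evalZero_neg {f : RatFunc ℂ} (hf : RegularAtZero f) :
    evalZero (-f) = -evalZero f := by
  have := evalZero_mul (regularAtZero_C (-1)) hf
  rw [evalZero_C] at this
  simpa using this

theorem evalZero_sub {f g : RatFunc ℂ} (hf : RegularAtZero f) (hg : RegularAtZero g) :
    evalZero (f - g) = evalZero f - evalZero g := by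
  rw [sub_eq_add_neg, evalZero_add hf hg.neg, evalZero_neg hg, sub_eq_add_neg]

theorem evalZero_pow {f : RatFunc ℂ} (hf : RegularAtZero f) (n : ℕ) :
    evalZero (f ^ n) = evalZero f ^ n := by
  induction n with
  | zero => simpa using evalZero_natCast 1
  | succ n ih => rw [pow_succ, evalZero_mul (hf.pow n) hf, ih, pow_succ]

/-- An element of the local ring with nonzero value at 0 is a unit. -/
theorem RegularAtZero.of_mul_eq {f g h : RatFunc ℂ} (hg : RegularAtZero g)
    (hh : RegularAtZero h) (hg0 : evalZero g ≠ 0) (e : f * g = h) : RegularAtZero f := by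
  obtain ⟨p, q, hq, h1⟩ := hg.exists_mul_eq
  obtain ⟨p', q', hq', h2⟩ := hh.exists_mul_eq
  have hp : p.eval 0 ≠ 0 := by
    have := congrArg evalZero h1
    rw [evalZero_mul hg (regularAtZero_algebraMap q), evalZero_algebraMap,
      evalZero_algebraMap] at this
    rw [← this]
    exact mul_ne_zero hg0 hq
  refine regularAtZero_of_mul_eq (p := p' * q) (q := p * q') (by simp [hp, hq']) ?_
  simp only [map_mul]
  linear_combination -f * ι q' * h1 + ι q * ι q' * e + ι q * h2

theorem RegularAtZero.exists_eq_X_mul {f : RatFunc ℂ} (hf : RegularAtZero f)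
    (h0 : evalZero f = 0) : ∃ g, RegularAtZero g ∧ f = RatFunc.X * g := by
  obtain ⟨p, q, hq, h⟩ := hf.exists_mul_eq
  have hp : p.eval 0 = 0 := by
    have := congrArg evalZero h
    rw [evalZero_mul hf (regularAtZero_algebraMap q), evalZero_algebraMap, h0, zero_mul,
      evalZero_algebraMap] at this
    exact this.symm
  obtain ⟨c, rfl⟩ := X_dvd_iff.2 ((coeff_zero_eq_eval_zero p).trans hp)
  have hq0 : ι q ≠ 0 := RatFunc.algebraMap_ne_zero (by rintro rfl; simp at hq)
  refine ⟨ι c / ι q, regularAtZero_of_mul_eq hq (div_mul_cancel₀ _ hq0), ?_⟩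
  rw [← mul_div_assoc, eq_div_iff hq0, h]
  simp

/-! ### Logarithmic form of the recurrence and the Adler–Moser relation. -/

/-- `S_{k+1} S_{k-1} / S_k²`. -/
def tauRatio (μ : ℂ) (k : ℕ) : RatFunc ℂ :=
  shiftedS μ (k + 2) * shiftedS μ k / shiftedS μ (k + 1) ^ 2

/-- The logarithmic derivative of `S_k / S_{k-1}`. -/
def logDerivDiff (μ : ℂ) (k : ℕ) : RatFunc ℂ :=
  logDeriv (shiftedS μ (k + 1)) - logDeriv (shiftedS μ k)

theorem tauRatio_mul (μ : ℂ) (k : ℕ) :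
    tauRatio μ k * shiftedS μ (k + 1) ^ 2 = shiftedS μ (k + 2) * shiftedS μ k :=
  div_mul_cancel₀ _ (pow_ne_zero 2 (shiftedS_ne_zero μ k).2)

theorem tauRatio_ne_zero (μ : ℂ) (k : ℕ) : tauRatio μ k ≠ 0 :=
  div_ne_zero (mul_ne_zero (shiftedS_ne_zero μ (k + 1)).2 (shiftedS_ne_zero μ k).1)
    (pow_ne_zero 2 (shiftedS_ne_zero μ k).2)

/-- The terms z (f f'' - f'²) + f f' are f² times the derivative of z f'/f. -/
theorem recRHS_eq (μ : ℂ) {f : RatFunc ℂ} (hf : f ≠ 0) :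
    recRHS μ f =
      (RatFunc.X + RatFunc.C μ - deriv (RatFunc.X * logDeriv f)) * f ^ 2 := by
  have h1 := deriv_eq_logDeriv_mul hf
  have h2 : deriv (deriv f) = deriv (logDeriv f) * f + logDeriv f * deriv f := by
    conv_lhs => rw [h1, deriv_mul]
  rw [recRHS, h2, deriv_mul, deriv_X, h1]
  ring

theorem tauRatio_eq (μ : ℂ) (k : ℕ) :
    tauRatio μ k = RatFunc.X + RatFunc.C μ -
      deriv (RatFunc.X * logDeriv (shiftedS μ (k + 1))) := by
  have h := (shiftedS_ne_zero μ k).2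
  rw [tauRatio, shiftedS_recurrence, recRHS_eq μ h, mul_div_cancel_right₀ _ (pow_ne_zero 2 h)]

theorem tauRatio_succ (μ : ℂ) (k : ℕ) :
    tauRatio μ (k + 1) = tauRatio μ k - deriv (RatFunc.X * logDerivDiff μ (k + 1)) := by
  rw [tauRatio_eq, tauRatio_eq, logDerivDiff, mul_sub, deriv_sub]
  ring

theorem deriv_tauRatio (μ : ℂ) (k : ℕ) :
    deriv (tauRatio μ k) =
      (logDerivDiff μ (k + 1) - logDerivDiff μ k) * tauRatio μ k := by
  have h0 := (shiftedS_ne_zero μ k).1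
  have h1 := (shiftedS_ne_zero μ k).2
  have h2 := (shiftedS_ne_zero μ (k + 1)).2
  have e := congrArg logDeriv (tauRatio_mul μ k)
  rw [pow_two, logDeriv_mul (tauRatio_ne_zero μ k) (mul_ne_zero h1 h1), logDeriv_mul h1 h1,
    logDeriv_mul h2 h0] at e
  rw [deriv_eq_logDeriv_mul (tauRatio_ne_zero μ k), logDerivDiff, logDerivDiff]
  congr 1
  linear_combination e

theorem shiftedS_zero (μ : ℂ) : shiftedS μ 0 = 1 := rfl

theorem shiftedS_one (μ : ℂ) : shiftedS μ 1 = 1 := rfl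

theorem logDerivDiff_zero (μ : ℂ) : logDerivDiff μ 0 = 0 := by
  simp [logDerivDiff, shiftedS_zero, shiftedS_one]

theorem deriv_zero : deriv 0 = 0 := by
  simpa using deriv_C 0

theorem tauRatio_zero (μ : ℂ) : tauRatio μ 0 = RatFunc.X + RatFunc.C μ := by
  rw [tauRatio_eq, shiftedS_one, logDeriv, deriv_one, zero_div, mul_zero, deriv_zero, sub_zero]

/-- The Adler–Moser relation `S_{k+1}' S_{k-1} - S_{k+1} S_{k-1}' = (2k+1) S_k²`, in terms of
logarithmic derivatives, together with the differential equation that propagates it. -/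
theorem adlerMoser_aux (μ : ℂ) (k : ℕ) :
    (logDerivDiff μ (k + 1) + logDerivDiff μ k) * tauRatio μ k = 2 * k + 1 ∧
    2 * deriv (tauRatio μ k) + deriv (deriv (RatFunc.X * logDerivDiff μ k)) -
      2 * logDerivDiff μ k * deriv (RatFunc.X * logDerivDiff μ k) = 2 := by
  induction k with
  | zero =>
    have h := deriv_tauRatio μ 0
    rw [logDerivDiff_zero, tauRatio_zero, deriv_add, deriv_X, deriv_C, sub_zero, add_zero] at h
    rw [logDerivDiff_zero, tauRatio_zero, deriv_add, deriv_X, deriv_C, mul_zero, deriv_zero,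
      deriv_zero]
    constructor
    · push_cast
      linear_combination -h
    · ring
  | succ k ih =>
    obtain ⟨hC, hK⟩ := ih
    have hr := deriv_tauRatio μ k
    have hr1 := deriv_tauRatio μ (k + 1)
    have hs := tauRatio_succ μ k
    have hs' := congrArg deriv hs
    set r := tauRatio μ k
    set E := logDerivDiff μ k
    set D := logDerivDiff μ (k + 1)
    have hr0 : r ≠ 0 := tauRatio_ne_zero μ k
    -- Differentiate (D + E) r = const, insert r' = (D - E) r and cancel r.
    have hP : deriv D + deriv E = -((D + E) * (D - E)) := by
      have h := congrArg deriv hC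
      have hc : deriv (2 * k + 1 : RatFunc ℂ) = 0 := by
        have := deriv_natCast (2 * k + 1)
        push_cast at this
        exact this
      rw [hc, deriv_mul, deriv_add, hr] at h
      refine mul_right_cancel₀ hr0 ?_
      linear_combination h
    have hP' := congrArg deriv hP
    rw [deriv_add, deriv_neg, deriv_mul, deriv_add, deriv_sub] at hP'
    have hE1 : deriv (RatFunc.X * E) = E + RatFunc.X * deriv E := by
      rw [deriv_mul, deriv_X, one_mul]
    have hE2 : deriv (deriv (RatFunc.X * E)) = 2 * deriv E + RatFunc.X * deriv (deriv E) := by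
      rw [hE1, deriv_add, deriv_mul, deriv_X]; ring
    have hD1 : deriv (RatFunc.X * D) = D + RatFunc.X * deriv D := by
      rw [deriv_mul, deriv_X, one_mul]
    have hD2 : deriv (deriv (RatFunc.X * D)) = 2 * deriv D + RatFunc.X * deriv (deriv D) := by
      rw [hD1, deriv_add, deriv_mul, deriv_X]; ring
    rw [hE2, hE1, hr] at hK
    rw [deriv_sub, hr, hD2] at hs'
    rw [hD1] at hs
    -- The left sides of the differential equation at k + 1 and at k differ by a combination of `hP`
    -- and its derivative.
    have key : 2 * deriv (tauRatio μ (k + 1)) + deriv (deriv (RatFunc.X * D)) -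
        2 * D * deriv (RatFunc.X * D) = 2 := by
      rw [hs', hD2, hD1]
      linear_combination hK - 2 * hP - RatFunc.X * hP'
    refine ⟨?_, key⟩
    rw [hs', hD2, hD1] at key
    rw [hr1] at hs'
    push_cast
    linear_combination hs' + 2 * D * hs + hC + key

theorem deriv_tauRatio_add (μ : ℂ) (k : ℕ) :
    deriv (tauRatio μ k) + 2 * logDerivDiff μ k * tauRatio μ k = 2 * k + 1 := by
  rw [deriv_tauRatio]
  linear_combination (adlerMoser_aux μ k).1

theorem two_mul_logDerivDiff_succ_mul (μ : ℂ) (k : ℕ) :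
    2 * logDerivDiff μ (k + 1) * tauRatio μ k = deriv (tauRatio μ k) + (2 * k + 1) := by
  rw [deriv_tauRatio]
  linear_combination (adlerMoser_aux μ k).1

theorem shiftedS_add_two (μ : ℂ) (k : ℕ) :
    shiftedS μ (k + 2) * shiftedS μ k = tauRatio μ k * shiftedS μ (k + 1) ^ 2 :=
  (tauRatio_mul μ k).symm

/-! ### Values at z = 0 while the sequence does not vanish there. -/

theorem evalZero_deriv_X_mul {f : RatFunc ℂ} (hf : RegularAtZero f) :
    evalZero (deriv (RatFunc.X * f)) = evalZero f := by
  rw [deriv_mul, deriv_X, one_mul, evalZero_add hf (regularAtZero_X.mul hf.deriv),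
    evalZero_mul regularAtZero_X hf.deriv, evalZero_X, zero_mul, add_zero]

theorem regularAtZero_two_mul_add_one (k : ℕ) : RegularAtZero (2 * k + 1 : RatFunc ℂ) := by
  have := regularAtZero_natCast (2 * k + 1)
  push_cast at this
  exact this

theorem evalZero_two_mul_add_one (k : ℕ) : evalZero (2 * k + 1 : RatFunc ℂ) = 2 * k + 1 := by
  have := evalZero_natCast (2 * k + 1)
  push_cast at this
  exact this

theorem evalZero_zero : evalZero (0 : RatFunc ℂ) = 0 := by
  simpa using evalZero_natCast 0

theorem regularAtZero_two : RegularAtZero (2 : RatFunc ℂ) := by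
  simpa using regularAtZero_natCast 2

theorem evalZero_two : evalZero (2 : RatFunc ℂ) = 2 := by
  simpa using evalZero_natCast 2

theorem regularAtZero_one : RegularAtZero (1 : RatFunc ℂ) := by
  simpa using regularAtZero_natCast 1

theorem evalZero_one : evalZero (1 : RatFunc ℂ) = 1 := by
  simpa using evalZero_natCast 1

/-- `S_{k-1}` and `S_k` are units at `z = 0`, and the quantities built from them have the values
there that the recurrence for `φ` rests on. -/
structure UnitAtZero (μ : ℂ) (k : ℕ) : Prop where
  reg : RegularAtZero (shiftedS μ k)
  ne : evalZero (shiftedS μ k) ≠ 0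
  reg_succ : RegularAtZero (shiftedS μ (k + 1))
  ne_succ : evalZero (shiftedS μ (k + 1)) ≠ 0
  reg_diff : RegularAtZero (logDerivDiff μ k)
  reg_ratio : RegularAtZero (tauRatio μ k)
  mul_eq : evalZero (tauRatio μ k) * (evalZero (tauRatio μ k) + evalZero (logDerivDiff μ k)) =
    μ ^ 2 - (k : ℂ) ^ 2
  -- For k ≥ 1 this sum is the previous ratio at 0. Its nonvanishing decides which factor of
  -- `mul_eq` is zero when μ² = k².
  ratio_add_ne : k ≠ 0 → evalZero (tauRatio μ k) + evalZero (logDerivDiff μ k) ≠ 0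

theorem unitAtZero_zero (μ : ℂ) : UnitAtZero μ 0 := by
  have h0 : RegularAtZero (0 : RatFunc ℂ) := by simpa using regularAtZero_C 0
  refine ⟨?_, ?_, ?_, ?_, ?_, ?_, ?_, fun h => absurd rfl h⟩
  · exact regularAtZero_one
  · rw [shiftedS_zero, evalZero_one]; exact one_ne_zero
  · exact regularAtZero_one
  · rw [shiftedS_one, evalZero_one]; exact one_ne_zero
  · rwa [logDerivDiff_zero]
  · rw [tauRatio_zero]; exact regularAtZero_X.add (regularAtZero_C μ)
  · rw [tauRatio_zero, logDerivDiff_zero, evalZero_add regularAtZero_X (regularAtZero_C μ),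
      evalZero_X, evalZero_C, evalZero_zero]
    push_cast
    ring

theorem UnitAtZero.regularAtZero_add_two {μ : ℂ} {k : ℕ} (h : UnitAtZero μ k) :
    RegularAtZero (shiftedS μ (k + 2)) :=
  h.reg.of_mul_eq (h.reg_ratio.mul (h.reg_succ.pow 2)) h.ne (shiftedS_add_two μ k)

theorem UnitAtZero.evalZero_add_two {μ : ℂ} {k : ℕ} (h : UnitAtZero μ k) :
    evalZero (shiftedS μ (k + 2)) * evalZero (shiftedS μ k) =
      evalZero (tauRatio μ k) * evalZero (shiftedS μ (k + 1)) ^ 2 := by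
  rw [← evalZero_mul h.regularAtZero_add_two h.reg, shiftedS_add_two,
    evalZero_mul h.reg_ratio (h.reg_succ.pow 2), evalZero_pow h.reg_succ]

theorem evalZero_tauRatio_succ {μ : ℂ} {k : ℕ} (h : RegularAtZero (logDerivDiff μ (k + 1)))
    (h' : RegularAtZero (tauRatio μ k)) :
    evalZero (tauRatio μ (k + 1)) + evalZero (logDerivDiff μ (k + 1)) =
      evalZero (tauRatio μ k) := by
  rw [tauRatio_succ, evalZero_sub h' (regularAtZero_X.mul h).deriv, evalZero_deriv_X_mul h]
  ring

/-- By `mul_eq`, μ² ≠ k² makes r_k a unit at 0, so D_{k+1} is regular. At 0 one then has r_{k+1} r_k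
= r_k² - D_{k+1} r_k = r_k (r_k + D_k) - (2k + 1), which turns μ² - k² into μ² - (k+1)². -/
theorem UnitAtZero.succ {μ : ℂ} {k : ℕ} (h : UnitAtZero μ k) (hk : μ ^ 2 ≠ (k : ℂ) ^ 2) :
    UnitAtZero μ (k + 1) := by
  have ha : evalZero (tauRatio μ k) ≠ 0 := by
    intro h0
    have := h.mul_eq
    rw [h0, zero_mul] at this
    exact hk (sub_eq_zero.1 this.symm)
  have hs := two_mul_logDerivDiff_succ_mul μ k
  have hd := h.reg_ratio.deriv
  have hc := regularAtZero_two_mul_add_one k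
  have hD : RegularAtZero (logDerivDiff μ (k + 1)) := by
    refine (regularAtZero_two.mul h.reg_ratio).of_mul_eq (hd.add hc) ?_
      (by linear_combination hs)
    rw [evalZero_mul regularAtZero_two h.reg_ratio, evalZero_two]
    exact mul_ne_zero two_ne_zero ha
  have e1 := congrArg evalZero hs
  rw [evalZero_mul (regularAtZero_two.mul hD) h.reg_ratio, evalZero_mul regularAtZero_two hD,
    evalZero_two, evalZero_add hd hc, evalZero_two_mul_add_one] at e1
  have e2 := congrArg evalZero (deriv_tauRatio_add μ k)
  rw [evalZero_add hd ((regularAtZero_two.mul h.reg_diff).mul h.reg_ratio),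
    evalZero_mul (regularAtZero_two.mul h.reg_diff) h.reg_ratio,
    evalZero_mul regularAtZero_two h.reg_diff, evalZero_two, evalZero_two_mul_add_one] at e2
  have e3 := evalZero_tauRatio_succ hD h.reg_ratio
  refine ⟨h.reg_succ, h.ne_succ, h.regularAtZero_add_two, ?_, hD, ?_, ?_, fun _ => by rwa [e3]⟩
  · intro h0
    have := h.evalZero_add_two
    rw [h0, zero_mul] at this
    exact mul_ne_zero ha (pow_ne_zero 2 h.ne_succ) this.symm
  · rw [tauRatio_succ]
    exact h.reg_ratio.sub (regularAtZero_X.mul hD).deriv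
  · rw [e3]
    push_cast
    linear_combination h.mul_eq + evalZero (tauRatio μ k) * e3 - e1 / 2 - e2 / 2

theorem unitAtZero_of_forall_ne {μ : ℂ} {k : ℕ} (h : ∀ j < k, μ ^ 2 ≠ (j : ℂ) ^ 2) :
    UnitAtZero μ k := by
  induction k with
  | zero => exact unitAtZero_zero μ
  | succ k ih =>
    exact (ih fun j hj => h j (hj.trans k.lt_succ_self)).succ (h k k.lt_succ_self)

/-! ### Orders of vanishing after μ² = M². -/

/-- The behaviour at `z = 0` when `μ² = M²` and the index is `M + j`. -/
structure LadderAtZero (μ : ℂ) (M j : ℕ) : Prop where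
  -- For j > 0, D has a simple pole with residue j and no constant term; at j = 0 it is regular with
  -- arbitrary value at 0.
  diff : ∃ y, RegularAtZero y ∧ RatFunc.X * logDerivDiff μ (M + j) = y ∧ evalZero y = j ∧
    (j = 0 ∨ evalZero (deriv y) = 0)
  ratio : ∃ h, RegularAtZero h ∧ tauRatio μ (M + j) = RatFunc.X * h
  order : ∃ (a : ℕ) (t t' : RatFunc ℂ), RegularAtZero t ∧ evalZero t ≠ 0 ∧
    RegularAtZero t' ∧ evalZero t' ≠ 0 ∧ shiftedS μ (M + j) = RatFunc.X ^ a * t ∧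
    shiftedS μ (M + j + 1) = RatFunc.X ^ (a + j) * t'

theorem UnitAtZero.ladderAtZero {μ : ℂ} {M : ℕ} (h : UnitAtZero μ M)
    (hM : μ ^ 2 = (M : ℂ) ^ 2) : LadderAtZero μ M 0 := by
  refine ⟨⟨_, regularAtZero_X.mul h.reg_diff, rfl, ?_, Or.inl rfl⟩,
    h.reg_ratio.exists_eq_X_mul ?_,
    ⟨0, _, _, h.reg, h.ne, h.reg_succ, h.ne_succ, by simp, by simp⟩⟩
  · rw [evalZero_mul regularAtZero_X h.reg_diff, evalZero_X]
    simp
  · have e := h.mul_eq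
    rw [hM, sub_self] at e
    rcases mul_eq_zero.1 e with e | e
    · exact e
    · by_cases h0 : M = 0
      · subst h0
        rw [logDerivDiff_zero, evalZero_zero, add_zero] at e
        exact e
      · exact absurd e (h.ratio_add_ne h0)

/-- Write r = z h, y = z D and w = z D_next. The relation for r and its derivative at 0 give h(0) ≠
0, w(0) = j + 1 and w'(0) = 0. Then r_next = z h - w' is again divisible by z, and the simple zero
of r fixes the next order of vanishing. -/
theorem LadderAtZero.succ {μ : ℂ} {M j : ℕ} (hL : LadderAtZero μ M j) :
    LadderAtZero μ M (j + 1) := by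
  obtain ⟨y, hy, hDy, hy0, hy1⟩ := hL.diff
  obtain ⟨h, hh, hr⟩ := hL.ratio
  obtain ⟨a, t, t', ht, ht0, ht', ht0', hs, hs'⟩ := hL.order
  have hdr : deriv (tauRatio μ (M + j)) = h + RatFunc.X * deriv h := by
    rw [hr, deriv_mul, deriv_X, one_mul]
  have hX := regularAtZero_X
  have h2 := regularAtZero_two
  have hc := regularAtZero_two_mul_add_one (M + j)
  have hc0 := evalZero_two_mul_add_one (M + j)
  have hd2 : deriv (2 : RatFunc ℂ) = 0 := by simpa using deriv_natCast 2
  have hdc : deriv (2 * (M + j : ℕ) + 1 : RatFunc ℂ) = 0 := by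
    have := deriv_natCast (2 * (M + j) + 1)
    push_cast at this ⊢
    exact this
  have e0 := deriv_tauRatio_add μ (M + j)
  have e0' := two_mul_logDerivDiff_succ_mul μ (M + j)
  set c : RatFunc ℂ := 2 * (M + j : ℕ) + 1
  -- `z = 0` in `r' + 2 D r = 2 n + 1` and in its derivative
  have e1 : h + RatFunc.X * deriv h + 2 * (y * h) = c := by
    rw [hdr, hr] at e0
    rw [← e0, ← hDy]
    ring
  have e1' := congrArg deriv e1
  rw [hdc, deriv_add, deriv_add, deriv_mul, deriv_X, deriv_mul, hd2, deriv_mul] at e1'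
  have v1 := congrArg evalZero e1
  rw [evalZero_add (hh.add (hX.mul hh.deriv)) (h2.mul (hy.mul hh)),
    evalZero_add hh (hX.mul hh.deriv), evalZero_mul hX hh.deriv, evalZero_X,
    evalZero_mul h2 (hy.mul hh), evalZero_mul hy hh, evalZero_two, hy0, hc0] at v1
  -- `v1` reads (2j + 1) h(0) = 2(M + j) + 1.
  have hh0 : evalZero h ≠ 0 := by
    intro h0
    rw [h0] at v1
    have : ((2 * (M + j) + 1 : ℕ) : ℂ) = 0 := by
      push_cast at v1 ⊢
      linear_combination -v1
    exact Nat.cast_ne_zero.2 (Nat.succ_ne_zero _) this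
  -- Only the product j h'(0) is needed for w'(0) = 0, so the unknown y'(0) at j = 0 does no harm;
  -- for j > 0 the differentiated relation gives (j + 1) h'(0) = 0.
  have hjh : (j : ℂ) * evalZero (deriv h) = 0 := by
    rcases hy1 with rfl | hy1
    · simp
    · have v := congrArg evalZero (show deriv h + deriv h + RatFunc.X * deriv (deriv h) +
        2 * (deriv y * h + y * deriv h) = 0 by linear_combination e1')
      rw [evalZero_add ((hh.deriv.add hh.deriv).add (hX.mul hh.deriv.deriv))
          (h2.mul ((hy.deriv.mul hh).add (hy.mul hh.deriv))),
        evalZero_add (hh.deriv.add hh.deriv) (hX.mul hh.deriv.deriv),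
        evalZero_add hh.deriv hh.deriv, evalZero_mul hX hh.deriv.deriv, evalZero_X,
        evalZero_mul h2 ((hy.deriv.mul hh).add (hy.mul hh.deriv)), evalZero_two,
        evalZero_add (hy.deriv.mul hh) (hy.mul hh.deriv), evalZero_mul hy.deriv hh,
        evalZero_mul hy hh.deriv, hy1, hy0,
        evalZero_zero] at v
      have hj : ((j + 1 : ℕ) : ℂ) ≠ 0 := Nat.cast_ne_zero.2 (Nat.succ_ne_zero _)
      have : ((j + 1 : ℕ) : ℂ) * evalZero (deriv h) = 0 := by
        push_cast
        linear_combination v / 2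
      rw [(mul_eq_zero.1 this).resolve_left hj, mul_zero]
  -- the next logarithmic derivative
  obtain ⟨w, hw⟩ : ∃ w, w = RatFunc.X * logDerivDiff μ (M + j + 1) := ⟨_, rfl⟩
  have e2 : w * (2 * h) = h + RatFunc.X * deriv h + c := by
    rw [← hdr, ← e0', hr, hw]
    ring
  have h2h : evalZero (2 * h) = 2 * evalZero h := by rw [evalZero_mul h2 hh, evalZero_two]
  have hwr : RegularAtZero w :=
    (h2.mul hh).of_mul_eq ((hh.add (hX.mul hh.deriv)).add hc)
      (by rw [h2h]; exact mul_ne_zero two_ne_zero hh0) e2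
  have e2' := congrArg deriv e2
  rw [deriv_mul, deriv_mul, hd2, deriv_add, deriv_add, deriv_mul, deriv_X, hdc] at e2'
  have v2 := congrArg evalZero e2
  rw [evalZero_mul hwr (h2.mul hh), h2h, evalZero_add (hh.add (hX.mul hh.deriv)) hc,
    evalZero_add hh (hX.mul hh.deriv), evalZero_mul hX hh.deriv, evalZero_X, hc0] at v2
  have hw0 : evalZero w = (j + 1 : ℕ) := by
    refine mul_right_cancel₀ (mul_ne_zero two_ne_zero hh0) ?_
    rw [v2]
    push_cast at v1 ⊢
    linear_combination -v1
  -- At 0 this identity reads w'(0) h(0) + (j + 1) h'(0) = h'(0), so w'(0) h(0) = -j h'(0) = 0.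
  have hw1 : evalZero (deriv w) = 0 := by
    have v := congrArg evalZero (show deriv w * h + w * deriv h =
      deriv h + RatFunc.X * deriv (deriv h) * RatFunc.C (1 / 2) by
        have hC : (2 : RatFunc ℂ) * RatFunc.C (1 / 2) = 1 := by
          have : (2 : RatFunc ℂ) = RatFunc.C 2 := (map_ofNat RatFunc.C 2).symm
          rw [this, ← map_mul]
          simp
        have h2' : (2 : RatFunc ℂ) ≠ 0 := two_ne_zero
        refine mul_left_cancel₀ h2' ?_
        linear_combination e2' - RatFunc.X * deriv (deriv h) * hC)
    rw [evalZero_add (hwr.deriv.mul hh) (hwr.mul hh.deriv), evalZero_mul hwr.deriv hh,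
      evalZero_mul hwr hh.deriv, hw0,
      evalZero_add hh.deriv ((hX.mul hh.deriv.deriv).mul (regularAtZero_C _)),
      evalZero_mul (hX.mul hh.deriv.deriv) (regularAtZero_C _),
      evalZero_mul hX hh.deriv.deriv, evalZero_X] at v
    push_cast at v
    have : evalZero (deriv w) * evalZero h = 0 := by linear_combination v - hjh
    exact (mul_eq_zero.1 this).resolve_right hh0
  refine ⟨⟨w, hwr, hw.symm, hw0, Or.inr hw1⟩, ?_, ?_⟩
  · obtain ⟨g, hg, e⟩ := hwr.deriv.exists_eq_X_mul hw1
    refine ⟨h - g, hh.sub hg, ?_⟩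
    rw [← add_assoc, tauRatio_succ, ← hw, e, hr]
    ring
  · have htn : t ≠ 0 := by
      rintro rfl
      exact ht0 evalZero_zero
    have hsx := shiftedS_add_two μ (M + j)
    have ht2 : RegularAtZero (h * t' ^ 2 / t) :=
      ht.of_mul_eq (hh.mul (ht'.pow 2)) ht0 (div_mul_cancel₀ _ htn)
    refine ⟨a + j, t', h * t' ^ 2 / t, ht', ht0', ht2, ?_, hs', ?_⟩
    · intro h0
      have e := congrArg evalZero (div_mul_cancel₀ (h * t' ^ 2) htn)
      rw [evalZero_mul ht2 ht, h0, zero_mul, evalZero_mul hh (ht'.pow 2), evalZero_pow ht'] at e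
      exact mul_ne_zero hh0 (pow_ne_zero 2 ht0') e.symm
    · rw [hr, hs, hs'] at hsx
      refine mul_right_cancel₀ (mul_ne_zero (pow_ne_zero a RatFunc.X_ne_zero) htn) ?_
      rw [show M + (j + 1) + 1 = M + j + 2 by ring, hsx]
      field_simp
      ring

theorem UnitAtZero.ladderAtZero_all {μ : ℂ} {M : ℕ} (h : UnitAtZero μ M)
    (hM : μ ^ 2 = (M : ℂ) ^ 2) (j : ℕ) : LadderAtZero μ M j := by
  induction j with
  | zero => exact h.ladderAtZero hM
  | succ j ih => exact ih.succ

/-- Either `S_{k-1}` and `S_k` are units at `z = 0`, or `μ² = M²` for some `M < k` and the first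
such `M` governs the order of vanishing. -/
theorem unitAtZero_or_ladderAtZero (μ : ℂ) (k : ℕ) :
    UnitAtZero μ k ∨ ∃ M j, k = M + (j + 1) ∧ LadderAtZero μ M (j + 1) := by
  induction k with
  | zero => exact Or.inl (unitAtZero_zero μ)
  | succ k ih =>
    rcases ih with h | ⟨M, j, rfl, h⟩
    · by_cases hk : μ ^ 2 = (k : ℂ) ^ 2
      · exact Or.inr ⟨k, 0, rfl, h.ladderAtZero_all hk 1⟩
      · exact Or.inl (h.succ hk)
    · exact Or.inr ⟨M, j + 1, rfl, h.succ⟩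

/-! ### Regularity, zeros of φ_n, and the two recurrences. -/

theorem LadderAtZero.regularAtZero_succ {μ : ℂ} {M j : ℕ} (h : LadderAtZero μ M j) :
    RegularAtZero (shiftedS μ (M + j + 1)) := by
  obtain ⟨a, t, t', -, -, ht', -, -, hs⟩ := h.order
  rw [hs]
  exact (regularAtZero_X.pow _).mul ht'

theorem LadderAtZero.evalZero_succ {μ : ℂ} {M j : ℕ} (h : LadderAtZero μ M (j + 1)) :
    evalZero (shiftedS μ (M + (j + 1) + 1)) = 0 := by
  obtain ⟨a, t, t', -, -, ht', -, -, hs⟩ := h.order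
  rw [hs, evalZero_mul (regularAtZero_X.pow _) ht', evalZero_pow regularAtZero_X, evalZero_X]
  simp

theorem regularAtZero_S (μ : ℂ) (n : ℕ) : RegularAtZero (S μ n) := by
  rcases unitAtZero_or_ladderAtZero μ n with h | ⟨M, j, rfl, h⟩
  · exact h.reg_succ
  · exact h.regularAtZero_succ

theorem unitAtZero_of_phi_ne_zero {μ : ℂ} {n : ℕ} (hn : phi μ n ≠ 0) : UnitAtZero μ n := by
  rcases unitAtZero_or_ladderAtZero μ n with h | ⟨M, j, rfl, h⟩
  · exact h
  · exact absurd h.evalZero_succ hn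

theorem finite_setOf_phi_eq_zero (n : ℕ) : {μ : ℂ | phi μ n = 0}.Finite := by
  refine ((Set.finite_Iio n).biUnion fun j _ =>
    (Set.toFinite {(j : ℂ), -(j : ℂ)})).subset fun μ hμ => ?_
  by_contra hcon
  refine (unitAtZero_of_forall_ne (μ := μ) (k := n) fun j hj e => hcon ?_).ne_succ hμ
  refine Set.mem_biUnion hj ?_
  simpa using sq_eq_sq_iff_eq_or_eq_neg.1 e

/-- At z = 0 the second-derivative term drops out, leaving only φ and φ'. -/
theorem phi_mul_phi (μ : ℂ) (n : ℕ) :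
    phi μ (n + 2) * phi μ n = -(phi μ (n + 1) * phi' μ (n + 1)) + μ * phi μ (n + 1) ^ 2 := by
  have h0 := regularAtZero_S μ n
  have h1 := regularAtZero_S μ (n + 1)
  have h2 := regularAtZero_S μ (n + 2)
  have hX := regularAtZero_X
  have hl := (h1.mul h1.deriv.deriv).sub (h1.deriv.pow 2)
  have hC := hX.add (regularAtZero_C μ)
  rw [phi, phi, phi, phi', ← evalZero_mul h2 h0, (S_recurrence μ).2.2 n, recRHS,
    evalZero_add ((hX.neg.mul hl).sub (h1.mul h1.deriv)) (hC.mul (h1.pow 2)),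
    evalZero_sub (hX.neg.mul hl) (h1.mul h1.deriv), evalZero_mul hX.neg hl, evalZero_neg hX,
    evalZero_mul h1 h1.deriv, evalZero_mul hC (h1.pow 2), evalZero_add hX (regularAtZero_C μ),
    evalZero_X, evalZero_C, evalZero_pow h1]
  ring

theorem phi_add_four {μ : ℂ} {n : ℕ} (h1 : phi μ (n + 1) ≠ 0) (h2 : phi μ (n + 2) ≠ 0) :
    phi μ (n + 4) = phi μ (n + 3) * phi μ (n + 2) / phi μ (n + 1) *
      (2 * μ ^ 2 - 2 * ((n + 3 : ℕ) : ℂ) ^ 2 + 2 * ((n + 3 : ℕ) : ℂ) - 1 -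
        phi μ (n + 3) * phi μ n / (phi μ (n + 2) * phi μ (n + 1))) := by
  -- φ_{n+3} may vanish, where the ratio argument is unavailable; `phi_mul_phi` then forces φ_{n+4}
  -- = 0 as well.
  by_cases h3 : phi μ (n + 3) = 0
  · have e := phi_mul_phi μ (n + 2)
    rw [h3] at e
    have : phi μ (n + 4) = 0 := by
      refine (mul_eq_zero.1 (?_ : phi μ (n + 4) * phi μ (n + 2) = 0)).resolve_right h2
      linear_combination e
    rw [this, h3]
    simp
  have u3 := unitAtZero_of_phi_ne_zero h3
  have u2 := unitAtZero_of_phi_ne_zero h2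
  have u1 := unitAtZero_of_phi_ne_zero h1
  have h0 : phi μ n ≠ 0 := u1.ne
  have e3 : phi μ (n + 4) * phi μ (n + 2) = evalZero (tauRatio μ (n + 3)) * phi μ (n + 3) ^ 2 :=
    u3.evalZero_add_two
  have e2 : phi μ (n + 3) * phi μ (n + 1) = evalZero (tauRatio μ (n + 2)) * phi μ (n + 2) ^ 2 :=
    u2.evalZero_add_two
  have e1 : phi μ (n + 2) * phi μ n = evalZero (tauRatio μ (n + 1)) * phi μ (n + 1) ^ 2 :=
    u1.evalZero_add_two
  have m3 := u3.mul_eq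
  have m2 := u2.mul_eq
  rw [evalZero_tauRatio_succ u3.reg_diff u2.reg_ratio] at m3
  rw [evalZero_tauRatio_succ u2.reg_diff u1.reg_ratio] at m2
  -- `m3` and `m2` are now r_k r_{k-1} = μ² - k² at 0, for k = n + 3 and k = n + 2.
  have q3 : phi μ (n + 4) =
      phi μ (n + 3) * phi μ (n + 2) / phi μ (n + 1) * (μ ^ 2 - ((n + 3 : ℕ) : ℂ) ^ 2) := by
    rw [← m3, eq_div_of_mul_eq h2 e3]
    field_simp
    linear_combination evalZero (tauRatio μ (n + 3)) * e2
  have q2 : phi μ (n + 3) * phi μ n / (phi μ (n + 2) * phi μ (n + 1)) =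
      μ ^ 2 - ((n + 2 : ℕ) : ℂ) ^ 2 := by
    rw [← m2, div_eq_iff (mul_ne_zero h2 h1)]
    refine mul_right_cancel₀ (mul_ne_zero h1 h2) ?_
    linear_combination phi μ n * phi μ (n + 2) * e2 +
      evalZero (tauRatio μ (n + 2)) * phi μ (n + 2) ^ 2 * e1
  rw [q2, q3]
  push_cast
  ring

end Umemura

end

theorem theorem4p1 :
    -- all `S_n(z; μ)` are regular at `z = 0`, so that `φ_n` and `φ_n'` are defined
    (∀ (μ : ℂ) (n : ℕ), Umemura.RegularAtZero (Umemura.S μ n)) ∧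
    -- no `φ_n` vanishes identically in `μ`, so that the denominators below are admissible
    (∀ n : ℕ, {μ : ℂ | Umemura.phi μ n = 0}.Finite) ∧
    -- the recurrence for `φ_n`
    (∀ (μ : ℂ) (n : ℕ), 3 ≤ n → Umemura.phi μ (n - 2) ≠ 0 → Umemura.phi μ (n - 1) ≠ 0 →
      Umemura.phi μ (n + 1) =
        Umemura.phi μ n * Umemura.phi μ (n - 1) / Umemura.phi μ (n - 2) *
          (2 * μ ^ 2 - 2 * (n : ℂ) ^ 2 + 2 * (n : ℂ) - 1 -
            Umemura.phi μ n * Umemura.phi μ (n - 3) /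
              (Umemura.phi μ (n - 1) * Umemura.phi μ (n - 2)))) ∧
    -- the recurrence for `φ_n'`
    (∀ (μ : ℂ) (n : ℕ), 3 ≤ n → Umemura.phi μ (n + 1) ≠ 0 →
      Umemura.phi' μ (n + 1) =
        -(Umemura.phi μ n * Umemura.phi μ (n + 2) / Umemura.phi μ (n + 1)) +
          μ * Umemura.phi μ (n + 1)) := by
  refine ⟨Umemura.regularAtZero_S, Umemura.finite_setOf_phi_eq_zero, fun μ n hn h1 h2 => ?_,
    fun μ n _ h => ?_⟩
  · obtain ⟨n, rfl⟩ := Nat.exists_eq_add_of_le' hn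
    exact Umemura.phi_add_four h1 h2
  · have e := Umemura.phi_mul_phi μ n
    field_simp
    linear_combination e
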